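/- Let $\mathbb{S}$ be the unit sphere of $\mathbb{R}^3$ with surface measure $\sigma$, let $\nabla_\sigma$ be the surface gradient on $\mathbb{S}$, and for $\ell\ge 0$ let $\mathcal{H}^\ell$ be the space of real spherical harmonics of degree $\ell$ (the restrictions to $\mathbb{S}$ of the real harmonic homogeneous polynomials of degree $\ell$ in three variables). For each $\ell\ge 0$ let $(Y_{\ell,m})_m$ be any orthonormal basis of $\mathcal{H}^\ell$ with respect to the $L^2(\mathbb{S},\sigma)$ inner product (usually indexed by the integers $|m|\le\ell$). For $\eta\in\mathbb{S}$ put $$E^+_{\ell,m}(\eta)=(\ell+1)Y_{\ell,m}(\eta)\,\eta-\nabla_\sigma Y_{\ell,m}(\eta),\qquad E^-_{\ell,m}(\eta)=\ell\, Y_{\ell,m}(\eta)\,\eta+\nabla_\sigma Y_{\ell,m}(\eta),\qquad E^0_{\ell,m}(\eta)=\eta\times\nabla_\sigma Y_{\ell,m}(\eta),$$ and let $E^+_\ell$, $E^-_\ell$, $E^0_\ell$ be the real linear spans of the fields $E^+_{\ell,m}$, $E^-_{\ell,m}$, $E^0_{\ell,m}$ respectively, over all $m$. Then: 1. The spaces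 $E^{\#}_\ell$ ($\#\in\{+,-,0\}$, $\ell\ge 0$) consist of square integrable vector fields and are mutually orthogonal: if $(\#,\ell)\neq(\#',\ell')$, then $\int_{\mathbb{S}} f\cdot g\,d\sigma=0$ for all $f\in E^{\#}_\ell$ and $g\in E^{\#'}_{\ell'}$. 2. Every element of $E^+_\ell$ ($\ell\ge 0$), of $E^-_\ell$ ($\ell\ge1$) and of $E^0_\ell$ ($\ell\ge 1$) is the restriction to $\mathbb{S}$ of a vector polynomial whose three components are harmonic and homogeneous of degree $\ell+1$, $\ell-1$ and $\ell$, respectively. 3. Let $L^2_+$, $L^2_-$ and $L^2_0$ be the closed linear spans in $L^2(\mathbb{S};\mathbb{R}^3)$ of $\bigcup_{\ell\ge0}E^+_\ell$, $\bigcup_{\ell\ge1}E^-_\ell$ and $\bigcup_{\ell\ge1}E^0_\ell$, respectively (so each is the Hilbert sum of the corresponding spaces). Then these three closed subspaces are pairwise orthogonal and $$L^2(\mathbb{S};\mathbb{R}^3)=L^2_+\oplus L^2_-\oplus L^2_0 .$$ -/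

import Mathlib

open MeasureTheory

noncomputable section

/-- Three-dimensional Euclidean space. -/
abbrev E3 : Type := EuclideanSpace ℝ (Fin 3)

/-- The unit sphere of `ℝ³`. -/
abbrev S2 : Type := Metric.sphere (0 : E3) 1

/-- The surface measure of the unit sphere (total mass `4π`). -/
abbrev surfaceMeasure : Measure S2 := (volume : Measure E3).toSphere

/-- The real Hilbert space `L²(S; ℝ³)` of square integrable vector fields on the sphere. -/
abbrev VecL2 : Type := Lp E3 2 surfaceMeasure

/-! ### Harmonic polynomials and spherical harmonics -/

/-- The Laplacian `∂₁² + ∂₂² + ∂₃²` on real polynomials in three variables. -/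
def polyLaplacian : MvPolynomial (Fin 3) ℝ →ₗ[ℝ] MvPolynomial (Fin 3) ℝ :=
  ∑ i : Fin 3, (MvPolynomial.pderiv i).toLinearMap ∘ₗ (MvPolynomial.pderiv i).toLinearMap

/-- The space of real harmonic homogeneous polynomials of degree `n` in three variables. -/
def harmonicHomogeneous (n : ℕ) : Submodule ℝ (MvPolynomial (Fin 3) ℝ) :=
  MvPolynomial.homogeneousSubmodule (Fin 3) ℝ n ⊓ LinearMap.ker polyLaplacian

/-- Restriction of a polynomial function to the sphere. -/
def restrictToSphere : MvPolynomial (Fin 3) ℝ →ₗ[ℝ] (S2 → ℝ) :=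
  LinearMap.pi fun η : S2 => (MvPolynomial.aeval (fun i => (η : E3) i)).toLinearMap

/-- `ℋ^ℓ`: the real spherical harmonics of degree `ℓ`, that is, the restrictions to the sphere of
the harmonic homogeneous polynomials of degree `ℓ`. -/
def sphericalHarmonics (l : ℕ) : Submodule ℝ (S2 → ℝ) :=
  (harmonicHomogeneous l).map restrictToSphere

/-- `Y` is an orthonormal basis of `ℋ^ℓ` for the inner product of `L²(S)`. (The index type is
arbitrary; the usual one is `{-ℓ, …, ℓ}`.) -/
structure IsSphericalHarmonicBasis (l : ℕ) {ι : Type*} (Y : ι → S2 → ℝ) : Prop where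
  span_eq : Submodule.span ℝ (Set.range Y) = sphericalHarmonics l
  integral_mul_self : ∀ m, ∫ η, Y m η * Y m η ∂surfaceMeasure = 1
  integral_mul_of_ne : ∀ m m', m ≠ m' → ∫ η, Y m η * Y m' η ∂surfaceMeasure = 0

/-! ### The spherical gradient -/

/-- The radial projection `x ↦ x / |x|` of `ℝ³ ∖ {0}` onto the sphere. -/
def radialProj (x : E3) (hx : x ≠ 0) : S2 :=
  ⟨‖x‖⁻¹ • x, by
    rw [mem_sphere_zero_iff_norm, norm_smul, norm_inv, norm_norm,
      inv_mul_cancel₀ (norm_ne_zero_iff.mpr hx)]⟩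

open Classical in
/-- The extension `x ↦ f (x / |x|)` of a function on the sphere to `ℝ³ ∖ {0}`, constant along
rays (with the irrelevant value `0` at the origin). -/
def radialExt (f : S2 → ℝ) (x : E3) : ℝ :=
  if hx : x ≠ 0 then f (radialProj x hx) else 0

/-- The surface gradient `∇_σ f` of a function on the sphere, as a (tangential) vector field with
values in `ℝ³`: the restriction to the sphere of the Euclidean gradient of `x ↦ f (x / |x|)`. -/
def sphGrad (f : S2 → ℝ) (η : S2) : E3 :=
  gradient (radialExt f) (η : E3)

/-! ### Vector spherical harmonics -/

/-- The cross product of `ℝ³`. -/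
def cross (u v : E3) : E3 :=
  WithLp.toLp 2 (crossProduct (WithLp.ofLp u) (WithLp.ofLp v))

/-- The three kinds `+`, `-`, `0` of vector spherical harmonics. -/
inductive Kind where
  | plus
  | minus
  | zero
  deriving DecidableEq

/-- The vector field made out of a scalar spherical harmonic `Y` of degree `ℓ`:
`(ℓ + 1) Y(η) η - ∇_σ Y(η)`, `ℓ Y(η) η + ∇_σ Y(η)` and `η × ∇_σ Y(η)`, respectively. -/
def vecHarmonic : Kind → ℕ → (S2 → ℝ) → S2 → E3
  | .plus, l, Y => fun η => (((l : ℝ) + 1) * Y η) • (η : E3) - sphGrad Y η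
  | .minus, l, Y => fun η => ((l : ℝ) * Y η) • (η : E3) + sphGrad Y η
  | .zero, _, Y => fun η => cross (η : E3) (sphGrad Y η)

/-- The spaces `E^+_ℓ`, `E^-_ℓ`, `E^0_ℓ`, spanned by the vector spherical harmonics built from the
functions `Y_{ℓ,m}`. -/
def vecHarmonicSpace {ι : ℕ → Type*} (Y : (l : ℕ) → ι l → S2 → ℝ) (k : Kind) (l : ℕ) :
    Submodule ℝ (S2 → E3) :=
  Submodule.span ℝ (Set.range fun m : ι l => vecHarmonic k l (Y l m))

/-- The vector field `f` on the sphere is the restriction of a vector polynomial whose three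
components are harmonic and homogeneous of degree `n`. -/
def IsRestrictionOfVecHarmonic (n : ℕ) (f : S2 → E3) : Prop :=
  ∃ P : Fin 3 → MvPolynomial (Fin 3) ℝ, (∀ i, P i ∈ harmonicHomogeneous n) ∧
    ∀ (η : S2) (i : Fin 3), f η i = MvPolynomial.eval (fun j => (η : E3) j) (P i)

/-! ### Subspaces of `L²(S; ℝ³)` -/

/-- The subspace of `L²(S; ℝ³)` formed by the classes of the elements of a space of vector fields
on the sphere. -/
def toVecL2 (V : Submodule ℝ (S2 → E3)) : Submodule ℝ VecL2 where
  carrier := {F | ∃ f ∈ V, F =ᵐ[surfaceMeasure] f}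
  zero_mem' := ⟨0, V.zero_mem, Lp.coeFn_zero _ _ _⟩
  add_mem' := by
    rintro F G ⟨f, hf, hF⟩ ⟨g, hg, hG⟩
    exact ⟨f + g, V.add_mem hf hg, (Lp.coeFn_add F G).trans (hF.add hG)⟩
  smul_mem' := by
    rintro c F ⟨f, hf, hF⟩
    exact ⟨c • f, V.smul_mem c hf, (Lp.coeFn_smul c F).trans (hF.const_smul c)⟩

/-- The lowest degree in the sum that defines each of the three subspaces of `L²(S; ℝ³)`. -/
def Kind.start : Kind → ℕ
  | .plus => 0
  | .minus => 1
  | .zero => 1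

/-- The closed subspaces `L²_+ = ⨁_{ℓ ≥ 0} E^+_ℓ`, `L²_- = ⨁_{ℓ ≥ 1} E^-_ℓ` and
`L²_0 = ⨁_{ℓ ≥ 1} E^0_ℓ` of `L²(S; ℝ³)`: the closed linear span of the `E_ℓ`. -/
def vecL2Part {ι : ℕ → Type*} (Y : (l : ℕ) → ι l → S2 → ℝ) (k : Kind) : Submodule ℝ VecL2 :=
  (⨆ (l : ℕ) (_ : k.start ≤ l), toVecL2 (vecHarmonicSpace Y k l)).topologicalClosure

end

noncomputable section

/-! Let `p` be harmonic and homogeneous of degree `l`. The extension of its restriction that is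
constant along rays is `|x|^{-l} p`, so on the sphere `∇_σ p = ∇p - l p η`. Hence the three fields
built from `p` are restrictions of the vector polynomials `(2l+1) p x - |x|² ∇p`, `∇p` and `x × ∇p`,
and these have harmonic components. From there everything is polynomial algebra together with one
analytic input, the rotation invariance of the measure.

Orthogonality. Differentiating `∫ p(R_t η)` in `t` gives `∫ L_i p = 0` for the components `L_i` of
`x × ∇` (`sphereIntegral_rotDeriv`), so each `L_i` is skew-adjoint. Since `∑ L_i² = -l(l+1)` on
harmonic polynomials of degree `l`, different degrees are orthogonal, and the integral of `∇p · ∇q`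
is an explicit multiple of that of `p q`. The remaining pairings reduce to Euler's relation, `x · (x
× ∇q) = 0` and `∑ L_i ∂_i = 0`.

Completeness. A vector polynomial `V` with harmonic components of the same degree is an explicit
combination of the three kinds, built from `x · V`, `div V` and `x · curl V`
(`vecPoly_decomposition`). On the sphere every polynomial is a sum of harmonic ones, because a
homogeneous polynomial is a sum of terms `|x|^{2k} h` (`mem_span_normSqPowMulHarmonic`).
Stone–Weierstrass and the density of continuous fields in `L²` make the sum of the three closed
subspaces dense, and orthogonality makes that sum closed. -/

open MvPolynomial in
/-- The polynomial `x₀² + x₁² + x₂²`. -/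
def polyNormSq : MvPolynomial (Fin 3) ℝ := X 0 * X 0 + X 1 * X 1 + X 2 * X 2

/-- The infinitesimal rotation about the `i`-th axis, that is, the `i`-th component of `x × ∇`. -/
def rotDeriv (i : Fin 3) : Derivation ℝ (MvPolynomial (Fin 3) ℝ) (MvPolynomial (Fin 3) ℝ) :=
  (MvPolynomial.X (i + 1) : MvPolynomial (Fin 3) ℝ) • MvPolynomial.pderiv (i + 2)
    - (MvPolynomial.X (i + 2) : MvPolynomial (Fin 3) ℝ) • MvPolynomial.pderiv (i + 1)

/-- The vector polynomial that restricts to `vecHarmonic k l p` on the sphere. -/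
def vecPoly : Kind → ℕ → MvPolynomial (Fin 3) ℝ →ₗ[ℝ] (Fin 3 → MvPolynomial (Fin 3) ℝ)
  | .plus, l => LinearMap.pi fun i =>
      LinearMap.mulLeft ℝ ((2 * (l : MvPolynomial (Fin 3) ℝ) + 1) * MvPolynomial.X i)
        - LinearMap.mulLeft ℝ polyNormSq ∘ₗ (MvPolynomial.pderiv i).toLinearMap
  | .minus, _ => LinearMap.pi fun i => (MvPolynomial.pderiv i).toLinearMap
  | .zero, _ => LinearMap.pi fun i => (rotDeriv i).toLinearMap

namespace MvPolynomial

/-- The commutator of two derivations is a derivation, and this one kills every variable. -/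
theorem pderiv_pderiv_comm {σ R : Type*} [CommRing R] (i j : σ) (p : MvPolynomial σ R) :
    pderiv i (pderiv j p) = pderiv j (pderiv i p) := by
  classical
  have h : ⁅(pderiv i : Derivation R (MvPolynomial σ R) (MvPolynomial σ R)),
      (pderiv j : Derivation R (MvPolynomial σ R) (MvPolynomial σ R))⁆ = 0 := by
    apply MvPolynomial.derivation_ext
    intro k
    by_cases h1 : k = i <;> by_cases h2 : k = j <;>
      simp [Derivation.commutator_apply, pderiv_X, Pi.single_apply, h1, h2, apply_ite]
  have := congrArg (fun D => D p) h
  simpa [Derivation.commutator_apply, sub_eq_zero] using this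

end MvPolynomial

open MvPolynomial

/-! ### Algebra of harmonic polynomials and harmonicity of the three vector polynomials -/

theorem vecPoly_plus (l : ℕ) (p : MvPolynomial (Fin 3) ℝ) (i : Fin 3) :
    vecPoly .plus l p i = (2 * (l : MvPolynomial (Fin 3) ℝ) + 1) * X i * p
      - polyNormSq * pderiv i p := rfl

theorem vecPoly_minus (l : ℕ) (p : MvPolynomial (Fin 3) ℝ) (i : Fin 3) :
    vecPoly .minus l p i = pderiv i p := rfl

theorem vecPoly_zero (l : ℕ) (p : MvPolynomial (Fin 3) ℝ) (i : Fin 3) :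
    vecPoly .zero l p i = rotDeriv i p := rfl

theorem rotDeriv_apply (i : Fin 3) (p : MvPolynomial (Fin 3) ℝ) :
    rotDeriv i p = X (i + 1) * pderiv (i + 2) p - X (i + 2) * pderiv (i + 1) p := rfl

theorem rotDeriv_zero (p : MvPolynomial (Fin 3) ℝ) :
    rotDeriv 0 p = X 1 * pderiv 2 p - X 2 * pderiv 1 p := rfl

theorem rotDeriv_one (p : MvPolynomial (Fin 3) ℝ) :
    rotDeriv 1 p = X 2 * pderiv 0 p - X 0 * pderiv 2 p := rfl

theorem rotDeriv_two (p : MvPolynomial (Fin 3) ℝ) :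
    rotDeriv 2 p = X 0 * pderiv 1 p - X 1 * pderiv 0 p := rfl

theorem polyLaplacian_apply (p : MvPolynomial (Fin 3) ℝ) :
    polyLaplacian p = pderiv 0 (pderiv 0 p) + pderiv 1 (pderiv 1 p) + pderiv 2 (pderiv 2 p) := by
  simp [polyLaplacian, Fin.sum_univ_three]

theorem polyLaplacian_pderiv (i : Fin 3) (p : MvPolynomial (Fin 3) ℝ) :
    polyLaplacian (pderiv i p) = pderiv i (polyLaplacian p) := by
  simp only [polyLaplacian_apply, map_add, pderiv_pderiv_comm i]

theorem polyLaplacian_X_mul (i : Fin 3) (p : MvPolynomial (Fin 3) ℝ) :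
    polyLaplacian (X i * p) = X i * polyLaplacian p + 2 * pderiv i p := by
  fin_cases i <;>
  simp [polyLaplacian_apply, Derivation.leibniz, pderiv_X] <;> ring

theorem polyLaplacian_natCast_mul (n : ℕ) (p : MvPolynomial (Fin 3) ℝ) :
    polyLaplacian ((n : MvPolynomial (Fin 3) ℝ) * p) = (n : MvPolynomial (Fin 3) ℝ) * polyLaplacian p := by
  rw [← nsmul_eq_mul, map_nsmul, nsmul_eq_mul]

theorem MvPolynomial.IsHomogeneous.euler {n : ℕ} {p : MvPolynomial (Fin 3) ℝ}
    (hp : p.IsHomogeneous n) :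
    X 0 * pderiv 0 p + X 1 * pderiv 1 p + X 2 * pderiv 2 p = (n : MvPolynomial (Fin 3) ℝ) * p := by
  simpa [Fin.sum_univ_three] using hp.sum_X_mul_pderiv

/-- The term `6` is `Δ|x|²`; the cross term is `4 x · ∇p`, equal to `4 n p` by Euler's relation. -/
theorem polyLaplacian_normSq_mul {n : ℕ} {p : MvPolynomial (Fin 3) ℝ} (hp : p.IsHomogeneous n) :
    polyLaplacian (polyNormSq * p) = polyNormSq * polyLaplacian p + (6 + 4 * (n : MvPolynomial (Fin 3) ℝ)) * p := by
  simp only [polyNormSq, add_mul, mul_assoc, map_add, polyLaplacian_X_mul, Derivation.leibniz,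
    pderiv_X_self, smul_eq_mul, mul_one]
  linear_combination 4 * hp.euler

theorem isHomogeneous_polyNormSq : polyNormSq.IsHomogeneous 2 :=
  (((isHomogeneous_X _ _).mul (isHomogeneous_X _ _)).add
    ((isHomogeneous_X _ _).mul (isHomogeneous_X _ _))).add
    ((isHomogeneous_X _ _).mul (isHomogeneous_X _ _))

theorem isHomogeneous_natCast (n : ℕ) : (n : MvPolynomial (Fin 3) ℝ).IsHomogeneous 0 := by
  simpa using isHomogeneous_C (Fin 3) (n : ℝ)

theorem mem_harmonicHomogeneous {n : ℕ} {p : MvPolynomial (Fin 3) ℝ} :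
    p ∈ harmonicHomogeneous n ↔ p.IsHomogeneous n ∧ polyLaplacian p = 0 := Iff.rfl

theorem isHomogeneous_rotDeriv {n : ℕ} {p : MvPolynomial (Fin 3) ℝ} (hp : p.IsHomogeneous n)
    (i : Fin 3) : (rotDeriv i p).IsHomogeneous n := by
  -- Degrees are truncated: in degree `0` the factor `X` would raise the degree to `1`, so constants
  -- are treated apart, where the derivative vanishes.
  rcases n with _ | n
  · rw [← totalDegree_zero_iff_isHomogeneous, totalDegree_eq_zero_iff_eq_C] at hp
    rw [hp, ← algebraMap_eq, Derivation.map_algebraMap]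
    exact isHomogeneous_zero _ _ _
  · rw [rotDeriv_apply, add_comm n]
    exact ((isHomogeneous_X _ _).mul hp.pderiv).sub ((isHomogeneous_X _ _).mul hp.pderiv)

theorem pderiv_mem_harmonicHomogeneous {n : ℕ} {p : MvPolynomial (Fin 3) ℝ}
    (hp : p ∈ harmonicHomogeneous n) (i : Fin 3) : pderiv i p ∈ harmonicHomogeneous (n - 1) :=
  ⟨hp.1.pderiv, by
    have := (mem_harmonicHomogeneous.1 hp).2
    change polyLaplacian _ = 0
    rw [polyLaplacian_pderiv, this, map_zero]⟩

theorem rotDeriv_mem_harmonicHomogeneous {n : ℕ} {p : MvPolynomial (Fin 3) ℝ}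
    (hp : p ∈ harmonicHomogeneous n) (i : Fin 3) : rotDeriv i p ∈ harmonicHomogeneous n :=
  ⟨isHomogeneous_rotDeriv hp.1 i, by
    have := (mem_harmonicHomogeneous.1 hp).2
    change polyLaplacian _ = 0
    simp only [rotDeriv_apply, map_sub, polyLaplacian_X_mul, polyLaplacian_pderiv, this, map_zero,
      mul_zero, zero_add]
    rw [pderiv_pderiv_comm, sub_self]⟩

/-- The factor `2n+1` is what harmonicity requires: `Δ(x_i p) = 2 ∂_i p`, while `Δ(|x|² ∂_i p) = (6
+ 4(n-1)) ∂_i p = 2(2n+1) ∂_i p`. -/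
theorem vecPoly_plus_mem {n : ℕ} {p : MvPolynomial (Fin 3) ℝ}
    (hp : p ∈ harmonicHomogeneous n) (i : Fin 3) :
    vecPoly .plus n p i ∈ harmonicHomogeneous (n + 1) := by
  obtain ⟨h1, h2⟩ := mem_harmonicHomogeneous.1 hp
  rw [vecPoly_plus]
  refine mem_harmonicHomogeneous.2 ⟨?_, ?_⟩
  · refine IsHomogeneous.sub ?_ ?_
    · have h := ((isHomogeneous_natCast (2 * n + 1)).mul (isHomogeneous_X ℝ i)).mul h1
      rw [show 0 + 1 + n = n + 1 by ring] at h
      simpa using h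
    · rcases n with _ | n
      · rw [← totalDegree_zero_iff_isHomogeneous, totalDegree_eq_zero_iff_eq_C] at h1
        rw [h1, pderiv_C, mul_zero]
        exact isHomogeneous_zero _ _ _
      · rw [show n + 1 + 1 = 2 + (n + 1 - 1) by omega]
        exact isHomogeneous_polyNormSq.mul h1.pderiv
  · have h3 := polyLaplacian_natCast_mul (2 * n + 1) (X i * p)
    push_cast at h3
    rw [map_sub, mul_assoc, h3, polyLaplacian_X_mul, h2]
    rcases n with _ | n
    · rw [← totalDegree_zero_iff_isHomogeneous, totalDegree_eq_zero_iff_eq_C] at h1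
      rw [h1, pderiv_C]
      simp
    · rw [polyLaplacian_normSq_mul h1.pderiv, polyLaplacian_pderiv, h2]
      simp
      ring

/-! ### Splitting harmonic vector polynomials into the three kinds -/

/-- The left side is a component of `x × ∇(x · curl V)`. After expansion, the second derivatives are
removed by Euler's relation for the `V c` and their first derivatives and by `ΔV = 0`. The identity
can be solved for `V i`, which is its role in the decomposition. -/
theorem rotDeriv_sum_rotDeriv {n : ℕ} {V : Fin 3 → MvPolynomial (Fin 3) ℝ}
    (hV : ∀ i, V i ∈ harmonicHomogeneous (n + 1)) (i : Fin 3) :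
    rotDeriv i (rotDeriv 0 (V 0) + rotDeriv 1 (V 1) + rotDeriv 2 (V 2)) =
      ((n : MvPolynomial (Fin 3) ℝ) + 1) * pderiv i (X 0 * V 0 + X 1 * V 1 + X 2 * V 2)
      + (n : MvPolynomial (Fin 3) ℝ) * X i * (pderiv 0 (V 0) + pderiv 1 (V 1) + pderiv 2 (V 2))
      - polyNormSq * pderiv i (pderiv 0 (V 0) + pderiv 1 (V 1) + pderiv 2 (V 2))
      - ((n : MvPolynomial (Fin 3) ℝ) + 1) * ((n : MvPolynomial (Fin 3) ℝ) + 2) * V i := by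
  have E (c : Fin 3) := (hV c).1.euler
  have E' (b c : Fin 3) := ((hV c).1.pderiv (i := b)).euler
  have D (c : Fin 3) := (mem_harmonicHomogeneous.1 (hV c)).2
  have c1 := pderiv_pderiv_comm (R := ℝ) (1 : Fin 3) 0
  have c2 := pderiv_pderiv_comm (R := ℝ) (2 : Fin 3) 0
  have c3 := pderiv_pderiv_comm (R := ℝ) (2 : Fin 3) 1
  simp only [polyLaplacian_apply] at D
  simp only [Nat.add_sub_cancel] at E'
  push_cast at E
  have key : ∀ i, i = 0 ∨ i = 1 ∨ i = (2 : Fin 3) := by decide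
  rcases key i with rfl | rfl | rfl
  · have h0 := E' 0 0; have h1 := E' 1 1; have h2 := E' 2 2
    have h01 := E' 0 1; have h02 := E' 0 2; have h10 := E' 1 0; have h20 := E' 2 0
    simp only [c1, c2, c3] at h0 h1 h2 h01 h02 h10 h20
    simp [rotDeriv_zero, rotDeriv_one, rotDeriv_two, Derivation.leibniz, pderiv_X, polyNormSq,
      c1, c2, c3]
    linear_combination -(1 + (n : MvPolynomial (Fin 3) ℝ)) * E 0 + X 0 * (h0 + h1 + h2)
      - X 0 * (X 0 * D 0 + X 1 * D 1 + X 2 * D 2) + (X 0 * h0 + X 1 * h01 + X 2 * h02)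
      + (X 0 * X 0 + X 1 * X 1 + X 2 * X 2) * D 0 - (X 0 * h0 + X 1 * h10 + X 2 * h20)
  · have h0 := E' 0 0; have h1 := E' 1 1; have h2 := E' 2 2
    have h01 := E' 0 1; have h12 := E' 1 2; have h10 := E' 1 0; have h21 := E' 2 1
    simp only [c1, c2, c3] at h0 h1 h2 h01 h12 h10 h21
    simp [rotDeriv_zero, rotDeriv_one, rotDeriv_two, Derivation.leibniz, pderiv_X, polyNormSq,
      c1, c2, c3]
    linear_combination -(1 + (n : MvPolynomial (Fin 3) ℝ)) * E 1 + X 1 * (h0 + h1 + h2)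
      - X 1 * (X 0 * D 0 + X 1 * D 1 + X 2 * D 2) + (X 0 * h10 + X 1 * h1 + X 2 * h12)
      + (X 0 * X 0 + X 1 * X 1 + X 2 * X 2) * D 1 - (X 0 * h01 + X 1 * h1 + X 2 * h21)
  · have h0 := E' 0 0; have h1 := E' 1 1; have h2 := E' 2 2
    have h20 := E' 2 0; have h21 := E' 2 1; have h02 := E' 0 2; have h12 := E' 1 2
    simp only [c1, c2, c3] at h0 h1 h2 h20 h21 h02 h12
    simp [rotDeriv_zero, rotDeriv_one, rotDeriv_two, Derivation.leibniz, pderiv_X, polyNormSq,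
      c1, c2, c3]
    linear_combination -(1 + (n : MvPolynomial (Fin 3) ℝ)) * E 2 + X 2 * (h0 + h1 + h2)
      - X 2 * (X 0 * D 0 + X 1 * D 1 + X 2 * D 2) + (X 0 * h20 + X 1 * h21 + X 2 * h2)
      + (X 0 * X 0 + X 1 * X 1 + X 2 * X 2) * D 2 - (X 0 * h02 + X 1 * h12 + X 2 * h2)

/-- A vector polynomial with harmonic homogeneous components of positive degree is the sum of
vector polynomials of the three kinds. -/
theorem vecPoly_decomposition {n : ℕ} {V : Fin 3 → MvPolynomial (Fin 3) ℝ}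
    (hV : ∀ i, V i ∈ harmonicHomogeneous (n + 1)) :
    ∃ h ∈ harmonicHomogeneous (n + 2), ∃ g ∈ harmonicHomogeneous n,
      ∃ w ∈ harmonicHomogeneous (n + 1),
        V = vecPoly .minus (n + 2) h + vecPoly .plus n g + vecPoly .zero (n + 1) w := by
  set f := X 0 * V 0 + X 1 * V 1 + X 2 * V 2 with hf
  set g := pderiv 0 (V 0) + pderiv 1 (V 1) + pderiv 2 (V 2) with hg
  set w := rotDeriv 0 (V 0) + rotDeriv 1 (V 1) + rotDeriv 2 (V 2) with hw
  have D (c : Fin 3) := (mem_harmonicHomogeneous.1 (hV c)).2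
  have hgm : g ∈ harmonicHomogeneous n :=
    add_mem (add_mem (pderiv_mem_harmonicHomogeneous (hV 0) 0)
      (pderiv_mem_harmonicHomogeneous (hV 1) 1)) (pderiv_mem_harmonicHomogeneous (hV 2) 2)
  have hwm : w ∈ harmonicHomogeneous (n + 1) :=
    add_mem (add_mem (rotDeriv_mem_harmonicHomogeneous (hV 0) 0)
      (rotDeriv_mem_harmonicHomogeneous (hV 1) 1)) (rotDeriv_mem_harmonicHomogeneous (hV 2) 2)
  -- `f = x · V` is not harmonic: `Δf = 2g`. Since `Δ(|x|² g) = (4n+6) g`, this combination is.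
  set h := ((2 * n + 3 : ℕ) : MvPolynomial (Fin 3) ℝ) * f - polyNormSq * g with hh
  have hhm : h ∈ harmonicHomogeneous (n + 2) := by
    refine mem_harmonicHomogeneous.2 ⟨?_, ?_⟩
    · refine IsHomogeneous.sub ?_ ?_
      · have hX (i : Fin 3) : (X i * V i).IsHomogeneous (n + 2) := by
          have := (isHomogeneous_X ℝ i).mul (hV i).1
          rwa [show 1 + (n + 1) = n + 2 by ring] at this
        have := (isHomogeneous_natCast (2 * n + 3)).mul (((hX 0).add (hX 1)).add (hX 2))
        rwa [zero_add] at this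
      · rw [add_comm n 2]
        exact isHomogeneous_polyNormSq.mul hgm.1
    · rw [hh, map_sub, polyLaplacian_natCast_mul, polyLaplacian_normSq_mul hgm.1,
        (mem_harmonicHomogeneous.1 hgm).2, hf]
      simp only [map_add, polyLaplacian_X_mul, D]
      rw [hg]
      push_cast
      ring
  -- Multiply the identity for `x × ∇w` by `2n+3` and replace `(2n+3) ∇f` by `∇h + |x|² ∇g + 2 g x`.
  -- The terms in `g` become `(n+2) ((2n+1) g x - |x|² ∇g)`, a field of the plus kind.
  set c : ℝ := (n + 1) * (n + 2) * (2 * n + 3) with hc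
  have hc0 : c ≠ 0 := by positivity
  have key : c • V = vecPoly .minus (n + 2) (((n : ℝ) + 1) • h) +
      vecPoly .plus n (((n : ℝ) + 2) • g) + vecPoly .zero (n + 1) ((-(2 * (n : ℝ) + 3)) • w) := by
    funext i
    have hi := rotDeriv_sum_rotDeriv hV i
    rw [← hf, ← hg, ← hw] at hi
    have hdh : pderiv i h = ((2 * n + 3 : ℕ) : MvPolynomial (Fin 3) ℝ) * pderiv i f
        - polyNormSq * pderiv i g - 2 * X i * g := by
      have hN : pderiv i polyNormSq = 2 * X i := by
        fin_cases i <;> simp [polyNormSq, pderiv_X] <;> ring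
      rw [hh, map_sub, ← nsmul_eq_mul, map_nsmul, nsmul_eq_mul, Derivation.leibniz, hN]
      simp only [smul_eq_mul]
      ring
    simp only [Pi.add_apply, Pi.smul_apply, map_smul]
    rw [vecPoly_minus, vecPoly_plus, vecPoly_zero, hi, hdh]
    simp only [smul_eq_C_mul, hc, map_add, map_mul, map_neg, map_natCast, map_ofNat, map_one]
    push_cast
    ring
  refine ⟨c⁻¹ • ((n : ℝ) + 1) • h, Submodule.smul_mem _ _ (Submodule.smul_mem _ _ hhm),
    c⁻¹ • ((n : ℝ) + 2) • g, Submodule.smul_mem _ _ (Submodule.smul_mem _ _ hgm),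
    c⁻¹ • (-(2 * (n : ℝ) + 3)) • w, Submodule.smul_mem _ _ (Submodule.smul_mem _ _ hwm), ?_⟩
  rw [map_smul _ c⁻¹, map_smul _ c⁻¹, map_smul _ c⁻¹, ← smul_add, ← smul_add, ← key,
    inv_smul_smul₀ hc0]

/-- A constant vector polynomial is a gradient of a linear form. -/
theorem vecPoly_decomposition_zero {V : Fin 3 → MvPolynomial (Fin 3) ℝ}
    (hV : ∀ i, V i ∈ harmonicHomogeneous 0) :
    ∃ h ∈ harmonicHomogeneous 1, V = vecPoly .minus 1 h := by
  have hC (i : Fin 3) : V i = C (coeff 0 (V i)) := by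
    have := (mem_harmonicHomogeneous.1 (hV i)).1
    rw [← totalDegree_zero_iff_isHomogeneous,
      totalDegree_eq_zero_iff_eq_C] at this
    exact this
  have hd (i j : Fin 3) : pderiv j (V i) = 0 := by rw [hC, pderiv_C]
  refine ⟨∑ i, X i * V i, ?_, ?_⟩
  · refine mem_harmonicHomogeneous.2 ⟨?_, ?_⟩
    · exact IsHomogeneous.sum _ _ _ fun i _ => (isHomogeneous_X ℝ i).mul (hV i).1
    · rw [map_sum]
      refine Finset.sum_eq_zero fun i _ => ?_
      rw [polyLaplacian_X_mul, hd, (mem_harmonicHomogeneous.1 (hV i)).2]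
      simp
  · funext i
    rw [vecPoly_minus, map_sum]
    simp [Derivation.leibniz, hd, pderiv_X, Pi.single_apply]

/-! ### Homogeneous polynomials in terms of harmonic ones -/

/-- The polynomials `|x|^{2k} h` of degree `n` with `h` harmonic. -/
def normSqPowMulHarmonic (n : ℕ) : Set (MvPolynomial (Fin 3) ℝ) :=
  {q | ∃ k d : ℕ, 2 * k + d = n ∧ ∃ h ∈ harmonicHomogeneous d, q = polyNormSq ^ k * h}

theorem isHomogeneous_of_mem_span_normSqPowMulHarmonic {n : ℕ} {p : MvPolynomial (Fin 3) ℝ}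
    (hp : p ∈ Submodule.span ℝ (normSqPowMulHarmonic n)) : p.IsHomogeneous n := by
  have : Submodule.span ℝ (normSqPowMulHarmonic n) ≤ homogeneousSubmodule (Fin 3) ℝ n := by
    rw [Submodule.span_le]
    rintro _ ⟨k, d, rfl, h, hh, rfl⟩
    exact (isHomogeneous_polyNormSq.pow k).mul hh.1
  exact this hp

/-- The Laplacian lowers the power of `|x|²` by one up to a nonzero factor, so the span in degree `m
+ 2` maps onto the span in degree `m`. Each induction step adds `6 + 4 deg` to the factor, where
`deg` is the degree of `|x|^{2(k+1)} h`; all contributions are positive. -/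
theorem exists_polyLaplacian_normSq_pow_mul {d : ℕ} {h : MvPolynomial (Fin 3) ℝ}
    (hh : h ∈ harmonicHomogeneous d) (k : ℕ) :
    ∃ a : ℝ, 0 < a ∧ polyLaplacian (polyNormSq ^ (k + 1) * h) = a • (polyNormSq ^ k * h) := by
  induction k with
  | zero =>
    refine ⟨6 + 4 * d, by positivity, ?_⟩
    rw [zero_add, pow_one, polyLaplacian_normSq_mul hh.1, (mem_harmonicHomogeneous.1 hh).2]
    simp only [smul_eq_C_mul, map_add, map_mul, map_natCast, map_ofNat]
    ring
  | succ k ih =>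
    obtain ⟨a, ha, hk⟩ := ih
    refine ⟨a + (6 + 4 * (2 * (k + 1) + d : ℕ)), by positivity, ?_⟩
    rw [pow_succ' _ (k + 1), mul_assoc,
      polyLaplacian_normSq_mul ((isHomogeneous_polyNormSq.pow (k + 1)).mul hh.1), hk]
    simp only [smul_eq_C_mul, map_add, map_mul, map_natCast, map_ofNat]
    ring

/-- Every homogeneous polynomial is a sum of `|x|^{2k} h` with `h` harmonic. -/
theorem mem_span_normSqPowMulHarmonic {n : ℕ} {p : MvPolynomial (Fin 3) ℝ}
    (hp : p.IsHomogeneous n) : p ∈ Submodule.span ℝ (normSqPowMulHarmonic n) := by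
  induction n using Nat.strong_induction_on generalizing p with
  | _ n ih =>
    have base (hq : polyLaplacian p = 0) : p ∈ Submodule.span ℝ (normSqPowMulHarmonic n) :=
      Submodule.subset_span ⟨0, n, by simp, p, ⟨hp, hq⟩, by simp⟩
    rcases lt_or_ge n 2 with hn | hn
    · refine base ?_
      have h1 (i : Fin 3) : pderiv i (pderiv i p) = 0 := by
        have h2 := hp.pderiv (i := i)
        rw [show n - 1 = 0 by omega, ← totalDegree_zero_iff_isHomogeneous,
          totalDegree_eq_zero_iff_eq_C] at h2
        rw [h2, pderiv_C]
      rw [polyLaplacian_apply, h1, h1, h1]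
      simp
    · obtain ⟨m, rfl⟩ := Nat.exists_eq_add_of_le hn
      have hL : (polyLaplacian p).IsHomogeneous m := by
        rw [polyLaplacian_apply]
        have h1 (i : Fin 3) : (pderiv i (pderiv i p)).IsHomogeneous m := by
          have h2 := (hp.pderiv (i := i)).pderiv (i := i)
          rwa [show 2 + m - 1 - 1 = m by omega] at h2
        exact ((h1 0).add (h1 1)).add (h1 2)
      have hs (s) (hs : s ∈ Submodule.span ℝ (normSqPowMulHarmonic m)) :
          ∃ u ∈ Submodule.span ℝ (normSqPowMulHarmonic (2 + m)), polyLaplacian u = s := by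
        induction hs using Submodule.span_induction with
        | mem x hx =>
          obtain ⟨k, d, rfl, h, hh, rfl⟩ := hx
          obtain ⟨a, ha, hk⟩ := exists_polyLaplacian_normSq_pow_mul hh k
          refine ⟨a⁻¹ • (polyNormSq ^ (k + 1) * h), Submodule.smul_mem _ _
            (Submodule.subset_span ⟨k + 1, d, by ring, h, hh, rfl⟩), ?_⟩
          rw [map_smul, hk, inv_smul_smul₀ ha.ne']
        | zero => exact ⟨0, zero_mem _, map_zero _⟩
        | add x y _ _ hx hy =>
          obtain ⟨u, hu, rfl⟩ := hx
          obtain ⟨v, hv, rfl⟩ := hy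
          exact ⟨u + v, add_mem hu hv, map_add _ _ _⟩
        | smul a x _ hx =>
          obtain ⟨u, hu, rfl⟩ := hx
          exact ⟨a • u, Submodule.smul_mem _ _ hu, map_smul _ _ _⟩
      -- By induction `Δp` is in the span in degree `m`; lifting it to `u` in the span in degree `2
      -- + m` leaves `p - u` harmonic.
      obtain ⟨u, hu, hup⟩ := hs _ (ih m (by omega) hL)
      have hd : p - u ∈ Submodule.span ℝ (normSqPowMulHarmonic (2 + m)) :=
        Submodule.subset_span ⟨0, 2 + m, by simp, p - u, ⟨hp.sub
          (isHomogeneous_of_mem_span_normSqPowMulHarmonic hu), by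
            change polyLaplacian _ = 0
            rw [map_sub, hup, sub_self]⟩, by simp⟩
      simpa using add_mem hd hu

/-! ### Polynomials as functions on `ℝ³` -/

theorem restrictToSphere_apply (p : MvPolynomial (Fin 3) ℝ) (η : S2) :
    restrictToSphere p η = eval (fun j => (η : E3) j) p := by
  simp [restrictToSphere, aeval_eq_eval]

/-- Restriction of a vector polynomial to the sphere. -/
def restrictVec : (Fin 3 → MvPolynomial (Fin 3) ℝ) →ₗ[ℝ] (S2 → E3) where
  toFun V η := WithLp.toLp 2 fun i => eval (fun j => (η : E3) j) (V i)
  map_add' V W := by ext η i; simp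
  map_smul' c V := by ext η i; simp

theorem restrictVec_apply (V : Fin 3 → MvPolynomial (Fin 3) ℝ) (η : S2) (i : Fin 3) :
    restrictVec V η i = eval (fun j => (η : E3) j) (V i) := rfl

theorem hasFDerivAt_eval (p : MvPolynomial (Fin 3) ℝ) (x : E3) :
    HasFDerivAt (fun y : E3 => eval (fun j => y j) p)
      (∑ i, eval (fun j => x j) (pderiv i p) • (EuclideanSpace.proj i : E3 →L[ℝ] ℝ)) x := by
  induction p using MvPolynomial.induction_on with
  | C a =>
    simp only [eval_C, pderiv_C, map_zero, zero_smul, Finset.sum_const_zero]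
    exact hasFDerivAt_const a x
  | add p q hp hq =>
    simp only [map_add, add_smul, Finset.sum_add_distrib]
    exact hp.add hq
  | mul_X p k hp =>
    have hX : HasFDerivAt (fun y : E3 => y k) (EuclideanSpace.proj k : E3 →L[ℝ] ℝ) x :=
      (EuclideanSpace.proj k : E3 →L[ℝ] ℝ).hasFDerivAt
    simp only [map_mul, eval_X]
    refine (hp.mul hX).congr_fderiv ?_
    simp only [Derivation.leibniz, smul_eq_mul, map_add, map_mul, eval_X, add_smul,
      Finset.sum_add_distrib, Finset.smul_sum, smul_smul, pderiv_X]
    congr 1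
    simp [Pi.single_apply, apply_ite]

theorem continuous_eval_euclidean (p : MvPolynomial (Fin 3) ℝ) :
    Continuous fun x : E3 => eval (fun j => x j) p :=
  continuous_iff_continuousAt.2 fun x => (hasFDerivAt_eval p x).continuousAt

theorem continuous_eval_sphere (p : MvPolynomial (Fin 3) ℝ) :
    Continuous fun η : S2 => eval (fun j => (η : E3) j) p :=
  (continuous_eval_euclidean p).comp continuous_subtype_val

theorem continuous_restrictVec (V : Fin 3 → MvPolynomial (Fin 3) ℝ) :
    Continuous (restrictVec V) :=
  (PiLp.continuous_toLp 2 _).comp (continuous_pi fun i => continuous_eval_sphere (V i))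

theorem sphere_sum_sq (η : S2) : (η : E3) 0 * (η : E3) 0 + (η : E3) 1 * (η : E3) 1
    + (η : E3) 2 * (η : E3) 2 = 1 := by
  have h : ‖(η : E3)‖ = 1 := mem_sphere_zero_iff_norm.1 η.2
  have h2 := EuclideanSpace.norm_sq_eq (η : E3)
  rw [h, Fin.sum_univ_three] at h2
  simp only [Real.norm_eq_abs, sq_abs] at h2
  linarith

theorem eval_polyNormSq (η : S2) : eval (fun j => (η : E3) j) polyNormSq = 1 := by
  simp [polyNormSq, sphere_sum_sq]

/-! ### The surface gradient of a spherical harmonic -/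

theorem hasFDerivAt_norm_sphere (η : S2) :
    HasFDerivAt (fun x : E3 => ‖x‖) (innerSL ℝ (η : E3)) (η : E3) := by
  have h : ‖(η : E3)‖ = 1 := mem_sphere_zero_iff_norm.1 η.2
  have h1 := ((hasStrictFDerivAt_norm_sq (η : E3)).hasFDerivAt).sqrt (by simp [h])
  simp only [Real.sqrt_sq (norm_nonneg _)] at h1
  refine h1.congr_fderiv ?_
  rw [h]
  ext y
  simp

theorem MvPolynomial.IsHomogeneous.eval_mul_left {σ R : Type*} [CommSemiring R]
    {l : ℕ} {p : MvPolynomial σ R} (hp : p.IsHomogeneous l) (c : R) (x : σ → R) :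
    eval (fun j => c * x j) p = c ^ l * eval x p := by
  rw [eval_eq, eval_eq, Finset.mul_sum]
  refine Finset.sum_congr rfl fun d hd => ?_
  simp only [mul_pow, Finset.prod_mul_distrib, Finset.prod_pow_eq_pow_sum]
  rw [hp.degree_eq_sum_deg_support hd]
  ring

theorem radialExt_restrictToSphere {l : ℕ} {p : MvPolynomial (Fin 3) ℝ} (hp : p.IsHomogeneous l)
    {x : E3} (hx : x ≠ 0) :
    radialExt (restrictToSphere p) x = (‖x‖ ^ l)⁻¹ * eval (fun j => x j) p := by
  rw [radialExt, dif_pos hx, restrictToSphere_apply, ← inv_pow]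
  exact hp.eval_mul_left _ _

/-- Product rule for `|x|^{-l} p` at a point with `|η| = 1`: the radial factor contributes `-l p η`.
-/
theorem sphGrad_restrictToSphere {l : ℕ} {p : MvPolynomial (Fin 3) ℝ} (hp : p.IsHomogeneous l)
    (η : S2) :
    sphGrad (restrictToSphere p) η = restrictVec (fun i => pderiv i p) η
      - (l * eval (fun j => (η : E3) j) p) • (η : E3) := by
  have h : ‖(η : E3)‖ = 1 := mem_sphere_zero_iff_norm.1 η.2
  have h0 : (η : E3) ≠ 0 := norm_ne_zero_iff.1 (by rw [h]; exact one_ne_zero)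
  have hpow : HasDerivAt (fun t : ℝ => (t ^ l)⁻¹) (-l) ‖(η : E3)‖ := by
    rw [h]
    simpa using (hasDerivAt_pow l (1 : ℝ)).fun_inv (by simp)
  have h1 := (hpow.comp_hasFDerivAt _ (hasFDerivAt_norm_sphere η)).mul (hasFDerivAt_eval p η)
  have h2 : HasGradientAt (radialExt (restrictToSphere p))
      (restrictVec (fun i => pderiv i p) η
        - (l * eval (fun j => (η : E3) j) p) • (η : E3)) (η : E3) := by
    rw [hasGradientAt_iff_hasFDerivAt]
    refine (h1.congr_of_eventuallyEq ?_).congr_fderiv ?_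
    · filter_upwards [isOpen_ne.mem_nhds h0] with x hx
      exact radialExt_restrictToSphere hp hx
    · ext y
      simp only [Function.comp, h, one_pow, inv_one, one_smul, map_sub]
      simp [restrictVec, PiLp.inner_apply, Fin.sum_univ_three]
      ring
  exact h2.gradient

theorem vecHarmonic_restrictToSphere (k : Kind) {l : ℕ} {p : MvPolynomial (Fin 3) ℝ}
    (hp : p.IsHomogeneous l) :
    vecHarmonic k l (restrictToSphere p) = restrictVec (vecPoly k l p) := by
  funext η
  cases k with
  | plus =>
    ext i
    simp [vecHarmonic, sphGrad_restrictToSphere hp, restrictVec_apply, vecPoly_plus,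
      restrictToSphere_apply, eval_polyNormSq]
    ring
  | minus =>
    ext i
    simp [vecHarmonic, sphGrad_restrictToSphere hp, restrictVec_apply, vecPoly_minus,
      restrictToSphere_apply]
  | zero =>
    ext i
    fin_cases i <;>
    simp [vecHarmonic, sphGrad_restrictToSphere hp, restrictVec_apply, vecPoly_zero, cross,
      crossProduct, rotDeriv_zero, rotDeriv_one, rotDeriv_two] <;> ring

/-! ### Rotation invariance of the surface measure -/

/-- The action of a linear isometry on the sphere. -/
def sphereRotate (e : E3 ≃ₗᵢ[ℝ] E3) : S2 ≃ₜ S2 where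
  toFun η := ⟨e η, by
    rw [mem_sphere_zero_iff_norm, e.norm_map]; exact mem_sphere_zero_iff_norm.1 η.2⟩
  invFun η := ⟨e.symm η, by
    rw [mem_sphere_zero_iff_norm, e.symm.norm_map]; exact mem_sphere_zero_iff_norm.1 η.2⟩
  left_inv η := by simp
  right_inv η := by simp
  continuous_toFun := by fun_prop
  continuous_invFun := by fun_prop

open Pointwise in
-- The surface measure of `s` is a multiple of the volume of the cone over `s`. The cone over a
-- preimage is the preimage of the cone, and linear isometries preserve volume.
theorem measurePreserving_sphereRotate (e : E3 ≃ₗᵢ[ℝ] E3) :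
    MeasurePreserving (sphereRotate e) surfaceMeasure surfaceMeasure := by
  refine ⟨(sphereRotate e).continuous.measurable, ?_⟩
  ext s hs
  have hm := (sphereRotate e).continuous.measurable
  rw [Measure.map_apply hm hs, surfaceMeasure, Measure.toSphere_apply' _ (hm hs),
    Measure.toSphere_apply' _ hs]
  have hset : Set.Ioo (0 : ℝ) 1 • ((↑) '' (sphereRotate e ⁻¹' s) : Set E3)
      = e ⁻¹' (Set.Ioo (0 : ℝ) 1 • ((↑) '' s : Set E3)) := by
    ext x
    simp only [Set.mem_smul, Set.mem_image, Set.mem_preimage]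
    constructor
    · rintro ⟨r, hr, _, ⟨η, hη, rfl⟩, rfl⟩
      exact ⟨r, hr, _, ⟨sphereRotate e η, hη, rfl⟩, by simp [sphereRotate]⟩
    · rintro ⟨r, hr, _, ⟨η, hη, rfl⟩, hx⟩
      refine ⟨r, hr, _, ⟨(sphereRotate e).symm η, by simpa using hη, rfl⟩, ?_⟩
      apply e.injective
      rw [← hx]
      simp [sphereRotate]
  rw [hset]
  congr 1
  exact e.measurePreserving.measure_preimage_emb
    e.toHomeomorph.measurableEmbedding _

theorem integral_comp_sphereRotate (e : E3 ≃ₗᵢ[ℝ] E3) (f : S2 → ℝ) :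
    ∫ η, f (sphereRotate e η) ∂surfaceMeasure = ∫ η, f η ∂surfaceMeasure :=
  (measurePreserving_sphereRotate e).integral_comp (sphereRotate e).measurableEmbedding f

/-- The rotation by the angle `t` about the `i`-th coordinate axis, as a linear map. -/
def axisRotationLinear (i : Fin 3) (t : ℝ) : E3 →ₗ[ℝ] E3 where
  toFun x := WithLp.toLp 2 fun j =>
    if j = i then x i
    else if j = i + 1 then Real.cos t * x (i + 1) - Real.sin t * x (i + 2)
    else Real.sin t * x (i + 1) + Real.cos t * x (i + 2)
  map_add' x y := by
    ext j
    simp only [PiLp.add_apply]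
    split_ifs <;> ring
  map_smul' c x := by
    ext j
    simp only [PiLp.smul_apply, smul_eq_mul, RingHom.id_apply]
    split_ifs <;> ring

theorem norm_axisRotationLinear (i : Fin 3) (t : ℝ) (x : E3) :
    ‖axisRotationLinear i t x‖ = ‖x‖ := by
  rw [EuclideanSpace.norm_eq, EuclideanSpace.norm_eq]
  congr 1
  simp only [Real.norm_eq_abs, sq_abs, Fin.sum_univ_three]
  have h := Real.sin_sq_add_cos_sq t
  fin_cases i <;> simp [axisRotationLinear]
  · linear_combination (x 1 ^ 2 + x 2 ^ 2) * h
  · linear_combination (x 0 ^ 2 + x 2 ^ 2) * h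
  · linear_combination (x 1 ^ 2 + x 0 ^ 2) * h

/-- The rotation by the angle `t` about the `i`-th coordinate axis. -/
def axisRotation (i : Fin 3) (t : ℝ) : E3 ≃ₗᵢ[ℝ] E3 :=
  LinearIsometry.toLinearIsometryEquiv ⟨axisRotationLinear i t, norm_axisRotationLinear i t⟩ rfl

theorem axisRotation_apply (i : Fin 3) (t : ℝ) (x : E3) :
    axisRotation i t x = axisRotationLinear i t x := rfl

/-- The velocity of the orbit at `y = R_t x` is `e_i × y`, and `(e_i × y) · ∇` is the `i`-th
component of `y × ∇`. All `t` are needed, since differentiation under the integral requires a bound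
on the derivative near `0`. -/
theorem hasDerivAt_eval_axisRotation (p : MvPolynomial (Fin 3) ℝ) (i : Fin 3) (x : E3) (t : ℝ) :
    HasDerivAt (fun s => eval (fun j => (axisRotation i s x) j) p)
      (eval (fun j => (axisRotation i t x) j) (rotDeriv i p)) t := by
  have hd : HasDerivAt (fun s => axisRotation i s x)
      (WithLp.toLp 2 fun j => if j = i then 0
        else if j = i + 1 then - (axisRotation i t x) (i + 2)
        else (axisRotation i t x) (i + 1)) t := by
    refine (EuclideanSpace.equiv (Fin 3) ℝ).symm.hasFDerivAt.comp_hasDerivAt t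
      (hasDerivAt_pi.2 fun j => ?_)
    have hs := Real.hasDerivAt_sin t
    have hc := Real.hasDerivAt_cos t
    by_cases h0 : j = i
    · simp only [h0, if_true]
      exact hasDerivAt_const t (x i)
    · by_cases h1 : j = i + 1
      · have h01 : ∀ i : Fin 3, i + 1 ≠ i := by decide
        have h2 : ∀ i : Fin 3, i + 2 ≠ i := by decide
        have h21 : ∀ i : Fin 3, i + 2 ≠ i + 1 := by decide
        simp only [h1, h01, h2, h21, if_true, if_false, axisRotation_apply, axisRotationLinear,
          LinearMap.coe_mk, AddHom.coe_mk]
        exact ((hc.mul_const _).sub (hs.mul_const _)).congr_deriv (by ring)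
      · have h01 : ∀ i : Fin 3, i + 1 ≠ i := by decide
        simp only [h0, h1, h01, if_true, if_false, axisRotation_apply, axisRotationLinear,
          LinearMap.coe_mk, AddHom.coe_mk]
        exact ((hs.mul_const _).add (hc.mul_const _)).congr_deriv (by ring)
  refine ((hasFDerivAt_eval p (axisRotation i t x)).comp_hasDerivAt t hd).congr_deriv ?_
  fin_cases i <;> simp [Fin.sum_univ_three, rotDeriv_zero, rotDeriv_one, rotDeriv_two] <;> ring

/-! ### Integration over the sphere and infinitesimal rotations -/

/-- The integral of a polynomial over the sphere. -/
def sphereIntegral : MvPolynomial (Fin 3) ℝ →ₗ[ℝ] ℝ where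
  toFun p := ∫ η : S2, eval (fun j => (η : E3) j) p ∂surfaceMeasure
  map_add' p q := by
    simp only [map_add]
    exact integral_add ((continuous_eval_sphere p).integrable_of_hasCompactSupport
      (HasCompactSupport.of_compactSpace _))
      ((continuous_eval_sphere q).integrable_of_hasCompactSupport
      (HasCompactSupport.of_compactSpace _))
  map_smul' c p := by
    simp only [smul_eval, RingHom.id_apply, smul_eq_mul]
    exact integral_const_mul _ _

theorem sphereIntegral_apply (p : MvPolynomial (Fin 3) ℝ) :
    sphereIntegral p = ∫ η : S2, eval (fun j => (η : E3) j) p ∂surfaceMeasure := rfl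

theorem sphereIntegral_polyNormSq_mul (p : MvPolynomial (Fin 3) ℝ) :
    sphereIntegral (polyNormSq * p) = sphereIntegral p := by
  simp [sphereIntegral_apply, eval_polyNormSq]

theorem continuous_eval_axisRotation (p : MvPolynomial (Fin 3) ℝ) (i : Fin 3) (t : ℝ) :
    Continuous fun η : S2 => eval (fun j => (axisRotation i t η) j) p := by
  have h : Continuous fun η : S2 => axisRotation i t η :=
    (axisRotation i t).continuous.comp continuous_subtype_val
  exact Continuous.comp (g := fun x : E3 => eval (fun j => x j) p)
    (continuous_eval_euclidean p) h

theorem integral_eval_axisRotation (p : MvPolynomial (Fin 3) ℝ) (i : Fin 3) (t : ℝ) :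
    ∫ η : S2, eval (fun j => (axisRotation i t η) j) p ∂surfaceMeasure = sphereIntegral p :=
  integral_comp_sphereRotate (axisRotation i t) fun η => eval (fun j => (η : E3) j) p

theorem exists_bound_eval_sphere (p : MvPolynomial (Fin 3) ℝ) :
    ∃ B, ∀ η : S2, ‖eval (fun j => (η : E3) j) p‖ ≤ B := by
  obtain ⟨B, hB⟩ := isCompact_univ.exists_bound_of_continuousOn
    (continuous_eval_sphere p).continuousOn
  exact ⟨B, fun η => hB η (Set.mem_univ _)⟩

/-- By rotation invariance `∫ p(R_t η)` does not depend on `t`; its derivative at `0` is the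
integral in question. -/
theorem sphereIntegral_rotDeriv (i : Fin 3) (p : MvPolynomial (Fin 3) ℝ) :
    sphereIntegral (rotDeriv i p) = 0 := by
  obtain ⟨B, hB⟩ := exists_bound_eval_sphere (rotDeriv i p)
  have h1 : ∀ᵐ η : S2 ∂surfaceMeasure, ∀ t ∈ (Set.univ : Set ℝ),
      ‖eval (fun j => (axisRotation i t η) j) (rotDeriv i p)‖ ≤ B :=
    Filter.Eventually.of_forall fun η t _ => hB (sphereRotate (axisRotation i t) η)
  have h2 : ∀ᵐ η : S2 ∂surfaceMeasure, ∀ t ∈ (Set.univ : Set ℝ),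
      HasDerivAt (fun s => eval (fun j => (axisRotation i s η) j) p)
        (eval (fun j => (axisRotation i t η) j) (rotDeriv i p)) t :=
    Filter.Eventually.of_forall fun η t _ => hasDerivAt_eval_axisRotation p i η t
  have h3 : Integrable (fun η : S2 => eval (fun j => (axisRotation i 0 η) j) p) surfaceMeasure :=
    (continuous_eval_axisRotation p i 0).integrable_of_hasCompactSupport
      (HasCompactSupport.of_compactSpace _)
  have h4 := (continuous_eval_axisRotation (rotDeriv i p) i 0).aestronglyMeasurable
    (μ := surfaceMeasure)
  have h5 : ∀ᶠ t in nhds (0 : ℝ), AEStronglyMeasurable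
      (fun η : S2 => eval (fun j => (axisRotation i t η) j) p) surfaceMeasure :=
    Filter.Eventually.of_forall fun t =>
      (continuous_eval_axisRotation p i t).aestronglyMeasurable
  have hder := (hasDerivAt_integral_of_dominated_loc_of_deriv_le Filter.univ_mem h5 h3 h4 h1
    (integrable_const B) h2).2
  -- Invariance makes the differentiated function constant and also removes the rotation from its
  -- derivative, so `R_0 = id` is never needed.
  simp only [integral_eval_axisRotation] at hder
  exact hder.unique (hasDerivAt_const _ _)

/-! ### Integrals of products of harmonic polynomials -/

theorem sphereIntegral_rotDeriv_mul (i : Fin 3) (p q : MvPolynomial (Fin 3) ℝ) :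
    sphereIntegral (rotDeriv i p * q) = - sphereIntegral (p * rotDeriv i q) := by
  have h := sphereIntegral_rotDeriv i (p * q)
  rw [Derivation.leibniz, map_add, smul_eq_mul, smul_eq_mul, mul_comm q] at h
  linarith

/-- The operator identity `∑ L_i² = |x|² Δ - E(E+1)`, where `E = x · ∇` acts as multiplication by
the degree. -/
theorem sum_rotDeriv_rotDeriv {l : ℕ} {p : MvPolynomial (Fin 3) ℝ}
    (hp : p ∈ harmonicHomogeneous l) :
    rotDeriv 0 (rotDeriv 0 p) + rotDeriv 1 (rotDeriv 1 p) + rotDeriv 2 (rotDeriv 2 p)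
      = -((l : ℝ) * (l + 1)) • p := by
  have E := hp.1.euler
  have D := (mem_harmonicHomogeneous.1 hp).2
  have c1 := pderiv_pderiv_comm (R := ℝ) (1 : Fin 3) 0
  have c2 := pderiv_pderiv_comm (R := ℝ) (2 : Fin 3) 0
  have c3 := pderiv_pderiv_comm (R := ℝ) (2 : Fin 3) 1
  have E0 := congrArg (pderiv 0) E
  have E1 := congrArg (pderiv 1) E
  have E2 := congrArg (pderiv 2) E
  rw [polyLaplacian_apply] at D
  simp [Derivation.leibniz, pderiv_X, c1, c2, c3] at E0 E1 E2
  simp [rotDeriv_zero, rotDeriv_one, rotDeriv_two, Derivation.leibniz, pderiv_X, c1, c2, c3,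
    smul_eq_C_mul]
  linear_combination (X 0 * X 0 + X 1 * X 1 + X 2 * X 2) * D - X 0 * E0 - X 1 * E1 - X 2 * E2
    - ((l : MvPolynomial (Fin 3) ℝ) + 1) * E

theorem sphereIntegral_rotDeriv_mul_rotDeriv {l : ℕ} {p : MvPolynomial (Fin 3) ℝ}
    (hp : p ∈ harmonicHomogeneous l) (q : MvPolynomial (Fin 3) ℝ) :
    sphereIntegral (rotDeriv 0 p * rotDeriv 0 q + rotDeriv 1 p * rotDeriv 1 q
      + rotDeriv 2 p * rotDeriv 2 q) = l * (l + 1) * sphereIntegral (p * q) := by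
  have h (i : Fin 3) : sphereIntegral (rotDeriv i p * rotDeriv i q)
      = - sphereIntegral (rotDeriv i (rotDeriv i p) * q) := by
    rw [sphereIntegral_rotDeriv_mul i (rotDeriv i p) q, neg_neg]
  rw [map_add, map_add, h, h, h, ← neg_add, ← neg_add, ← map_add, ← map_add, ← add_mul, ← add_mul,
    sum_rotDeriv_rotDeriv hp, smul_mul_assoc, map_smul, smul_eq_mul]
  ring

/-- Eigenfunctions of the symmetric operator `∑ L_i²` with different eigenvalues: `l(l+1) - l'(l'+1)
= (l-l')(l+l'+1)`. -/
theorem sphereIntegral_mul_eq_zero {l l' : ℕ} {p q : MvPolynomial (Fin 3) ℝ}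
    (hp : p ∈ harmonicHomogeneous l) (hq : q ∈ harmonicHomogeneous l') (hl : l ≠ l') :
    sphereIntegral (p * q) = 0 := by
  have h1 := sphereIntegral_rotDeriv_mul_rotDeriv hp q
  have h2 := sphereIntegral_rotDeriv_mul_rotDeriv hq p
  simp only [mul_comm (rotDeriv _ q)] at h2
  rw [h1, mul_comm q] at h2
  have h3 : ((l : ℝ) - l') * (l + l' + 1) * sphereIntegral (p * q) = 0 := by
    linear_combination h2
  have h4 : (l : ℝ) - l' ≠ 0 := sub_ne_zero.2 (Nat.cast_injective.ne hl)
  have h5 : (l : ℝ) + l' + 1 ≠ 0 := by positivity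
  simpa [h4, h5] using h3

/-- Lagrange's identity `|x|² ∇p·∇q = (x×∇p)·(x×∇q) + (x·∇p)(x·∇q)`. The asymmetry of the
coefficient in `l`, `l'` is harmless, because the integral of `p q` vanishes unless `l = l'`. -/
theorem sphereIntegral_grad_mul_grad {l l' : ℕ} {p q : MvPolynomial (Fin 3) ℝ}
    (hp : p ∈ harmonicHomogeneous l) (hq : q ∈ harmonicHomogeneous l') :
    sphereIntegral (pderiv 0 p * pderiv 0 q + pderiv 1 p * pderiv 1 q + pderiv 2 p * pderiv 2 q)
      = (l * (l + 1) + l * l') * sphereIntegral (p * q) := by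
  have hE := hp.1.euler
  have hE' := hq.1.euler
  have key : polyNormSq *
      (pderiv 0 p * pderiv 0 q + pderiv 1 p * pderiv 1 q + pderiv 2 p * pderiv 2 q)
      = (rotDeriv 0 p * rotDeriv 0 q + rotDeriv 1 p * rotDeriv 1 q + rotDeriv 2 p * rotDeriv 2 q)
        + ((l : ℝ) * l') • (p * q) := by
    simp only [rotDeriv_zero, rotDeriv_one, rotDeriv_two, polyNormSq, smul_eq_C_mul, map_mul,
      map_natCast]
    linear_combination (X 0 * pderiv 0 q + X 1 * pderiv 1 q + X 2 * pderiv 2 q) * hE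
      + (l : MvPolynomial (Fin 3) ℝ) * p * hE'
  rw [← sphereIntegral_polyNormSq_mul, key, map_add, sphereIntegral_rotDeriv_mul_rotDeriv hp,
    map_smul, smul_eq_mul]
  ring

/-- Integration by parts moves `L_i` onto `∂_i p`, and `∑ L_i ∂_i = (x × ∇) · ∇ = 0`. -/
theorem sphereIntegral_grad_mul_rotDeriv (p q : MvPolynomial (Fin 3) ℝ) :
    sphereIntegral (pderiv 0 p * rotDeriv 0 q + pderiv 1 p * rotDeriv 1 q
      + pderiv 2 p * rotDeriv 2 q) = 0 := by
  have h (i : Fin 3) : sphereIntegral (pderiv i p * rotDeriv i q)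
      = - sphereIntegral (rotDeriv i (pderiv i p) * q) := by
    rw [sphereIntegral_rotDeriv_mul i (pderiv i p) q, neg_neg]
  have h0 : rotDeriv 0 (pderiv 0 p) + rotDeriv 1 (pderiv 1 p) + rotDeriv 2 (pderiv 2 p) = 0 := by
    simp only [rotDeriv_zero, rotDeriv_one, rotDeriv_two,
      pderiv_pderiv_comm (1 : Fin 3) 0, pderiv_pderiv_comm (2 : Fin 3) 0,
      pderiv_pderiv_comm (2 : Fin 3) 1]
    ring
  rw [map_add, map_add, h, h, h, ← neg_add, ← neg_add, ← map_add, ← map_add, ← add_mul, ← add_mul,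
    h0, zero_mul, map_zero, neg_zero]

theorem sphereIntegral_vecPoly_comm (k k' : Kind) (l l' : ℕ) (p q : MvPolynomial (Fin 3) ℝ) :
    sphereIntegral (∑ i, vecPoly k l p i * vecPoly k' l' q i)
      = sphereIntegral (∑ i, vecPoly k' l' q i * vecPoly k l p i) := by
  simp only [mul_comm]

theorem sphereIntegral_plus_plus {l l' : ℕ} {p q : MvPolynomial (Fin 3) ℝ}
    (hp : p ∈ harmonicHomogeneous l) (hq : q ∈ harmonicHomogeneous l') (hl : l ≠ l') :
    sphereIntegral (∑ i, vecPoly .plus l p i * vecPoly .plus l' q i) = 0 := by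
  have key : ∑ i, vecPoly .plus l p i * vecPoly .plus l' q i
      = polyNormSq * (((2 * (l : ℝ) + 1) * (2 * l' + 1) - (2 * (l : ℝ) + 1) * l'
          - (2 * (l' : ℝ) + 1) * l) • (p * q)
        + polyNormSq * (pderiv 0 p * pderiv 0 q + pderiv 1 p * pderiv 1 q
          + pderiv 2 p * pderiv 2 q)) := by
    simp only [vecPoly_plus, Fin.sum_univ_three, smul_eq_C_mul, map_mul, map_add, map_sub,
      map_natCast, map_ofNat, map_one]
    have hN : (polyNormSq : MvPolynomial (Fin 3) ℝ) = X 0 * X 0 + X 1 * X 1 + X 2 * X 2 := rfl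
    linear_combination
      - (2 * (l : MvPolynomial (Fin 3) ℝ) + 1) * p * polyNormSq * hq.1.euler
      - (2 * (l' : MvPolynomial (Fin 3) ℝ) + 1) * q * polyNormSq * hp.1.euler
      - (2 * (l : MvPolynomial (Fin 3) ℝ) + 1) * (2 * (l' : MvPolynomial (Fin 3) ℝ) + 1)
        * p * q * hN
  rw [key, sphereIntegral_polyNormSq_mul, map_add, sphereIntegral_polyNormSq_mul,
    sphereIntegral_grad_mul_grad hp hq, map_smul, sphereIntegral_mul_eq_zero hp hq hl]
  simp

theorem sphereIntegral_plus_minus {l l' : ℕ} {p q : MvPolynomial (Fin 3) ℝ}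
    (hp : p ∈ harmonicHomogeneous l) (hq : q ∈ harmonicHomogeneous l') :
    sphereIntegral (∑ i, vecPoly .plus l p i * vecPoly .minus l' q i) = 0 := by
  have key : ∑ i, vecPoly .plus l p i * vecPoly .minus l' q i
      = ((2 * (l : ℝ) + 1) * l') • (p * q)
        - polyNormSq * (pderiv 0 p * pderiv 0 q + pderiv 1 p * pderiv 1 q
          + pderiv 2 p * pderiv 2 q) := by
    simp only [vecPoly_plus, vecPoly_minus, Fin.sum_univ_three, smul_eq_C_mul, map_mul, map_add,
      map_natCast, map_ofNat, map_one]
    linear_combination (2 * (l : MvPolynomial (Fin 3) ℝ) + 1) * p * hq.1.euler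
  rw [key, map_sub, sphereIntegral_polyNormSq_mul, sphereIntegral_grad_mul_grad hp hq, map_smul]
  -- In equal degrees nothing vanishes separately: the radial term and the gradient term are both
  -- `l(2l+1) ∫ p q` and cancel.
  by_cases hl : l = l'
  · subst hl
    rw [smul_eq_mul]
    ring
  · rw [sphereIntegral_mul_eq_zero hp hq hl]
    simp

theorem sphereIntegral_plus_zero (l l' : ℕ) (p q : MvPolynomial (Fin 3) ℝ) :
    sphereIntegral (∑ i, vecPoly .plus l p i * vecPoly .zero l' q i) = 0 := by
  have key : ∑ i, vecPoly .plus l p i * vecPoly .zero l' q i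
      = - (polyNormSq * (pderiv 0 p * rotDeriv 0 q + pderiv 1 p * rotDeriv 1 q
          + pderiv 2 p * rotDeriv 2 q)) := by
    simp only [vecPoly_plus, vecPoly_zero, Fin.sum_univ_three, rotDeriv_zero, rotDeriv_one,
      rotDeriv_two]
    ring
  rw [key, map_neg, sphereIntegral_polyNormSq_mul, sphereIntegral_grad_mul_rotDeriv, neg_zero]

theorem sphereIntegral_vecPoly {k k' : Kind} {l l' : ℕ} {p q : MvPolynomial (Fin 3) ℝ}
    (hp : p ∈ harmonicHomogeneous l) (hq : q ∈ harmonicHomogeneous l') (h : (k, l) ≠ (k', l')) :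
    sphereIntegral (∑ i, vecPoly k l p i * vecPoly k' l' q i) = 0 := by
  have hmz (l l' : ℕ) (p q : MvPolynomial (Fin 3) ℝ) :
      sphereIntegral (∑ i, vecPoly .minus l p i * vecPoly .zero l' q i) = 0 := by
    rw [Fin.sum_univ_three]
    exact sphereIntegral_grad_mul_rotDeriv p q
  cases k <;> cases k'
  · exact sphereIntegral_plus_plus hp hq (by simpa using h)
  · exact sphereIntegral_plus_minus hp hq
  · exact sphereIntegral_plus_zero l l' p q
  · rw [sphereIntegral_vecPoly_comm]
    exact sphereIntegral_plus_minus hq hp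
  · have := sphereIntegral_grad_mul_grad hp hq
    rw [sphereIntegral_mul_eq_zero hp hq (by simpa using h), mul_zero] at this
    rw [Fin.sum_univ_three]
    exact this
  · exact hmz l l' p q
  · rw [sphereIntegral_vecPoly_comm]
    exact sphereIntegral_plus_zero l' l q p
  · rw [sphereIntegral_vecPoly_comm]
    exact hmz l' l q p
  · have := sphereIntegral_rotDeriv_mul_rotDeriv hp q
    rw [sphereIntegral_mul_eq_zero hp hq (by simpa using h), mul_zero] at this
    rw [Fin.sum_univ_three]
    exact this

theorem integral_inner_restrictVec (V W : Fin 3 → MvPolynomial (Fin 3) ℝ) :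
    ∫ η, inner ℝ (restrictVec V η) (restrictVec W η) ∂surfaceMeasure
      = sphereIntegral (∑ i, V i * W i) := by
  rw [sphereIntegral_apply]
  congr 1
  funext η
  simp [PiLp.inner_apply, restrictVec_apply, mul_comm]

/-! ### The spaces of vector spherical harmonics -/

/-- This removes the choice of basis: only the fact that the `Y l m` span the spherical harmonics
enters. -/
theorem vecHarmonicSpace_eq_map {ι : ℕ → Type*} (Y : (l : ℕ) → ι l → S2 → ℝ)
    (hY : ∀ l, IsSphericalHarmonicBasis l (Y l)) (k : Kind) (l : ℕ) :
    vecHarmonicSpace Y k l = (harmonicHomogeneous l).map (restrictVec ∘ₗ vecPoly k l) := by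
  apply le_antisymm
  · rw [vecHarmonicSpace, Submodule.span_le]
    rintro _ ⟨m, rfl⟩
    have hm : Y l m ∈ sphericalHarmonics l :=
      (hY l).span_eq ▸ Submodule.subset_span ⟨m, rfl⟩
    obtain ⟨p, hp, hpm⟩ := hm
    exact ⟨p, hp, by beta_reduce; rw [← hpm]; exact (vecHarmonic_restrictToSphere k hp.1).symm⟩
  · rintro _ ⟨p, hp, rfl⟩
    -- The induction carries a polynomial lift `q` of `Z`, because `sphGrad` is defined by
    -- `gradient` and is additive only where differentiability is known; on polynomials the
    -- linearity comes from `vecPoly`.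
    have key (Z : S2 → ℝ) (hZ : Z ∈ Submodule.span ℝ (Set.range (Y l))) :
        ∃ q ∈ harmonicHomogeneous l, restrictToSphere q = Z ∧
          restrictVec (vecPoly k l q) ∈ vecHarmonicSpace Y k l := by
      induction hZ using Submodule.span_induction with
      | mem x hx =>
        obtain ⟨m, rfl⟩ := hx
        have hm : Y l m ∈ sphericalHarmonics l :=
          (hY l).span_eq ▸ Submodule.subset_span ⟨m, rfl⟩
        obtain ⟨q, hq, hqm⟩ := hm
        refine ⟨q, hq, hqm, ?_⟩
        rw [← vecHarmonic_restrictToSphere k hq.1, hqm]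
        exact Submodule.subset_span ⟨m, rfl⟩
      | zero => exact ⟨0, zero_mem _, map_zero _, by simp⟩
      | add x y _ _ hx hy =>
        obtain ⟨q, hq, rfl, hq'⟩ := hx
        obtain ⟨r, hr, rfl, hr'⟩ := hy
        exact ⟨q + r, add_mem hq hr, map_add _ _ _, by
          rw [map_add, map_add]; exact add_mem hq' hr'⟩
      | smul a x _ hx =>
        obtain ⟨q, hq, rfl, hq'⟩ := hx
        exact ⟨a • q, Submodule.smul_mem _ _ hq, map_smul _ _ _, by
          rw [map_smul, map_smul]; exact Submodule.smul_mem _ _ hq'⟩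
    have hmem : restrictToSphere p ∈ Submodule.span ℝ (Set.range (Y l)) := by
      rw [(hY l).span_eq]
      exact ⟨p, hp, rfl⟩
    obtain ⟨q, hq, hqp, hq'⟩ := key _ hmem
    -- The lift `q` need not be `p`, but both have the same restriction, and the field depends only
    -- on the restriction.
    rw [← vecHarmonic_restrictToSphere k hq.1, hqp, vecHarmonic_restrictToSphere k hp.1] at hq'
    exact hq'

theorem memLp_restrictVec (V : Fin 3 → MvPolynomial (Fin 3) ℝ) :
    MemLp (restrictVec V) 2 surfaceMeasure :=
  (continuous_restrictVec V).memLp_of_hasCompactSupport (HasCompactSupport.of_compactSpace _)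

/-- The class in `L²(S; ℝ³)` of the restriction of a vector polynomial. -/
def polyVecL2 : (Fin 3 → MvPolynomial (Fin 3) ℝ) →ₗ[ℝ] VecL2 where
  toFun V := (memLp_restrictVec V).toLp
  map_add' V W := by
    rw [← MemLp.toLp_add]
    exact MemLp.toLp_congr _ _ (by rw [map_add])
  map_smul' c V := by
    rw [RingHom.id_apply, ← MemLp.toLp_const_smul]
    exact MemLp.toLp_congr _ _ (by rw [map_smul])

theorem polyVecL2_coeFn (V : Fin 3 → MvPolynomial (Fin 3) ℝ) :
    polyVecL2 V =ᵐ[surfaceMeasure] restrictVec V := (memLp_restrictVec V).coeFn_toLp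

theorem polyVecL2_congr {V W : Fin 3 → MvPolynomial (Fin 3) ℝ}
    (h : restrictVec V = restrictVec W) : polyVecL2 V = polyVecL2 W :=
  MemLp.toLp_congr (memLp_restrictVec V) (memLp_restrictVec W) (by rw [h])

theorem polyVecL2_vecPoly_mem {ι : ℕ → Type*} (Y : (l : ℕ) → ι l → S2 → ℝ)
    (hY : ∀ l, IsSphericalHarmonicBasis l (Y l)) (k : Kind) {l : ℕ} (hl : k.start ≤ l)
    {p : MvPolynomial (Fin 3) ℝ} (hp : p ∈ harmonicHomogeneous l) :
    polyVecL2 (vecPoly k l p) ∈ ⨆ k, vecL2Part Y k := by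
  refine Submodule.mem_iSup_of_mem k (Submodule.le_topologicalClosure _ ?_)
  refine Submodule.mem_iSup_of_mem l (Submodule.mem_iSup_of_mem hl ?_)
  refine ⟨restrictVec (vecPoly k l p), ?_, polyVecL2_coeFn _⟩
  rw [vecHarmonicSpace_eq_map Y hY]
  exact ⟨p, hp, rfl⟩

theorem polyVecL2_harmonic_mem {ι : ℕ → Type*} (Y : (l : ℕ) → ι l → S2 → ℝ)
    (hY : ∀ l, IsSphericalHarmonicBasis l (Y l)) {n : ℕ} {V : Fin 3 → MvPolynomial (Fin 3) ℝ}
    (hV : ∀ i, V i ∈ harmonicHomogeneous n) :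
    polyVecL2 V ∈ ⨆ k, vecL2Part Y k := by
  rcases n with _ | n
  · obtain ⟨h, hh, rfl⟩ := vecPoly_decomposition_zero hV
    exact polyVecL2_vecPoly_mem Y hY _ le_rfl hh
  · obtain ⟨h, hh, g, hg, w, hw, rfl⟩ := vecPoly_decomposition hV
    rw [map_add, map_add]
    -- The degrees `n + 2`, `n` and `n + 1` respect the starting degrees `1`, `0` and `1` of the
    -- minus, plus and zero parts.
    exact add_mem (add_mem (polyVecL2_vecPoly_mem Y hY _ (Nat.le_add_left _ _) hh)
      (polyVecL2_vecPoly_mem Y hY _ (Nat.zero_le _) hg))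
      (polyVecL2_vecPoly_mem Y hY _ (Nat.le_add_left _ _) hw)

theorem restrictVec_single_normSq_pow_mul (i : Fin 3) (k : ℕ) (p : MvPolynomial (Fin 3) ℝ) :
    restrictVec (Pi.single i (polyNormSq ^ k * p)) = restrictVec (Pi.single i p) := by
  ext η j
  rw [restrictVec_apply, restrictVec_apply]
  by_cases h : j = i
  · subst h
    simp [eval_polyNormSq]
  · simp [h]

/-- Split `p` into homogeneous components and these into terms `|x|^{2k} h`; on the sphere the
powers of `|x|²` disappear, leaving a field with harmonic components. -/
theorem polyVecL2_single_mem {ι : ℕ → Type*} (Y : (l : ℕ) → ι l → S2 → ℝ)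
    (hY : ∀ l, IsSphericalHarmonicBasis l (Y l)) (i : Fin 3) (p : MvPolynomial (Fin 3) ℝ) :
    polyVecL2 (Pi.single i p) ∈ ⨆ k, vecL2Part Y k := by
  let φ : MvPolynomial (Fin 3) ℝ →ₗ[ℝ] VecL2 :=
    polyVecL2 ∘ₗ LinearMap.single ℝ (fun _ : Fin 3 => MvPolynomial (Fin 3) ℝ) i
  have hle (n : ℕ) : Submodule.span ℝ (normSqPowMulHarmonic n) ≤
      (⨆ k, vecL2Part Y k).comap φ := by
    rw [Submodule.span_le]
    rintro _ ⟨k, d, -, h, hh, rfl⟩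
    change polyVecL2 (Pi.single i (polyNormSq ^ k * h)) ∈ ⨆ k, vecL2Part Y k
    rw [polyVecL2_congr (restrictVec_single_normSq_pow_mul i k h)]
    refine polyVecL2_harmonic_mem Y hY (n := d) fun j => ?_
    by_cases hj : j = i
    · subst hj
      simpa using hh
    · simp [hj]
  change p ∈ (⨆ k, vecL2Part Y k).comap φ
  rw [← sum_homogeneousComponent p]
  exact Submodule.sum_mem _ fun n _ =>
    hle n (mem_span_normSqPowMulHarmonic (homogeneousComponent_isHomogeneous n p))

/-! ### Density of the polynomials -/

/-- Restriction of polynomials to the sphere, with values in the continuous functions. -/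
def polyContinuous : MvPolynomial (Fin 3) ℝ →ₐ[ℝ] C(S2, ℝ) :=
  aeval fun i => ⟨fun η => (η : E3) i,
    (EuclideanSpace.proj i : E3 →L[ℝ] ℝ).continuous.comp continuous_subtype_val⟩

theorem polyContinuous_apply (p : MvPolynomial (Fin 3) ℝ) (η : S2) :
    polyContinuous p η = eval (fun j => (η : E3) j) p := by
  induction p using MvPolynomial.induction_on with
  | C a => simp [polyContinuous]
  | add p q hp hq => simp [hp, hq]
  | mul_X p k hp =>
    rw [map_mul, ContinuousMap.mul_apply, hp, map_mul, eval_X, polyContinuous, aeval_X]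
    rfl

/-- Stone–Weierstrass: the coordinate functions separate the points of the sphere. -/
theorem polyContinuous_range_topologicalClosure :
    polyContinuous.range.topologicalClosure = ⊤ := by
  refine ContinuousMap.subalgebra_topologicalClosure_eq_top_of_separatesPoints _ ?_
  intro η ζ h
  have h1 : ∃ i, (η : E3) i ≠ (ζ : E3) i := by
    by_contra! hc
    exact h (Subtype.ext (PiLp.ext hc))
  obtain ⟨i, hi⟩ := h1
  exact ⟨polyContinuous (X i), ⟨polyContinuous (X i), ⟨X i, rfl⟩, rfl⟩, by
    simpa [polyContinuous_apply] using hi⟩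

/-- The class in `L²(S; ℝ³)` of the field `f e_i`. -/
def coordFieldL2 (i : Fin 3) : C(S2, ℝ) →L[ℝ] VecL2 :=
  (ContinuousMap.toLp (E := E3) 2 surfaceMeasure ℝ).comp
    ((ContinuousLinearMap.toSpanSingleton ℝ
      (EuclideanSpace.single i (1 : ℝ) : E3)).compLeftContinuous ℝ S2)

theorem coordFieldL2_polyContinuous (i : Fin 3) (p : MvPolynomial (Fin 3) ℝ) :
    coordFieldL2 i (polyContinuous p) = polyVecL2 (Pi.single i p) := by
  apply Lp.ext
  refine (ContinuousMap.coeFn_toLp _ _).trans ?_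
  refine Filter.EventuallyEq.trans (Filter.Eventually.of_forall fun η => ?_)
    (polyVecL2_coeFn _).symm
  ext j
  rw [restrictVec_apply]
  by_cases h : j = i
  · subst h
    simp [polyContinuous_apply]
  · simp [h]

theorem coordFieldL2_mem_topologicalClosure {ι : ℕ → Type*} (Y : (l : ℕ) → ι l → S2 → ℝ)
    (hY : ∀ l, IsSphericalHarmonicBasis l (Y l)) (i : Fin 3) (f : C(S2, ℝ)) :
    coordFieldL2 i f ∈ (⨆ k, vecL2Part Y k).topologicalClosure := by
  have hf : f ∈ closure (polyContinuous.range : Set C(S2, ℝ)) := by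
    rw [← Subalgebra.topologicalClosure_coe, polyContinuous_range_topologicalClosure]
    trivial
  refine map_mem_closure (coordFieldL2 i).continuous hf ?_
  rintro _ ⟨p, rfl⟩
  have := polyVecL2_single_mem Y hY i p
  rw [← coordFieldL2_polyContinuous] at this
  exact this

/-- Continuous fields are dense in `L²`, and each is the sum of its three coordinate fields, which
are limits of polynomial ones. -/
theorem topologicalClosure_iSup_vecL2Part {ι : ℕ → Type*} (Y : (l : ℕ) → ι l → S2 → ℝ)
    (hY : ∀ l, IsSphericalHarmonicBasis l (Y l)) :
    (⨆ k, vecL2Part Y k).topologicalClosure = ⊤ := by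
  have hd := ContinuousMap.toLp_denseRange (p := 2) E3 surfaceMeasure ℝ (by simp)
  rw [eq_top_iff]
  rintro F -
  refine closure_minimal ?_ (Submodule.isClosed_topologicalClosure _) (hd F)
  rintro _ ⟨f, rfl⟩
  have hf : ContinuousMap.toLp (E := E3) 2 surfaceMeasure ℝ f =
      ∑ i, coordFieldL2 i ⟨fun η => f η i,
        (EuclideanSpace.proj i : E3 →L[ℝ] ℝ).continuous.comp f.continuous⟩ := by
    simp only [coordFieldL2, ContinuousLinearMap.comp_apply, ← map_sum]
    congr 1
    ext η j
    simp [Fin.sum_univ_three]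
    fin_cases j <;> simp <;> rfl
  rw [hf]
  exact Submodule.sum_mem _ fun i _ => coordFieldL2_mem_topologicalClosure Y hY i _

/-! ### Orthogonality -/

theorem integral_inner_vecHarmonicSpace {ι : ℕ → Type*} (Y : (l : ℕ) → ι l → S2 → ℝ)
    (hY : ∀ l, IsSphericalHarmonicBasis l (Y l)) {k k' : Kind} {l l' : ℕ}
    (h : (k, l) ≠ (k', l')) {f g : S2 → E3} (hf : f ∈ vecHarmonicSpace Y k l)
    (hg : g ∈ vecHarmonicSpace Y k' l') :
    ∫ η, inner ℝ (f η) (g η) ∂surfaceMeasure = 0 := by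
  rw [vecHarmonicSpace_eq_map Y hY] at hf hg
  obtain ⟨p, hp, rfl⟩ := hf
  obtain ⟨q, hq, rfl⟩ := hg
  exact (integral_inner_restrictVec _ _).trans (sphereIntegral_vecPoly hp hq h)

theorem isOrtho_toVecL2 {V W : Submodule ℝ (S2 → E3)}
    (h : ∀ f ∈ V, ∀ g ∈ W, ∫ η, inner ℝ (f η) (g η) ∂surfaceMeasure = 0) :
    toVecL2 V ⟂ toVecL2 W := by
  rw [Submodule.isOrtho_iff_inner_eq]
  rintro F ⟨f, hf, hF⟩ G ⟨g, hg, hG⟩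
  rw [L2.inner_def, ← h f hf g hg]
  refine integral_congr_ae ?_
  filter_upwards [hF, hG] with η h1 h2
  rw [h1, h2]

/-- An orthogonal complement is closed, so either side may be replaced by its closure. -/
theorem Submodule.IsOrtho.topologicalClosure {𝕜 E : Type*} [RCLike 𝕜] [NormedAddCommGroup E]
    [InnerProductSpace 𝕜 E] {U V : Submodule 𝕜 E} (h : U ⟂ V) :
    U.topologicalClosure ⟂ V.topologicalClosure := by
  have key {U V : Submodule 𝕜 E} (h : U ⟂ V) : U.topologicalClosure ⟂ V :=
    Submodule.topologicalClosure_minimal _ h (Submodule.isClosed_orthogonal _)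
  exact (key (key h).symm).symm

theorem isOrtho_vecL2Part {ι : ℕ → Type*} (Y : (l : ℕ) → ι l → S2 → ℝ)
    (hY : ∀ l, IsSphericalHarmonicBasis l (Y l)) {k k' : Kind} (h : k ≠ k') :
    vecL2Part Y k ⟂ vecL2Part Y k' := by
  refine Submodule.IsOrtho.topologicalClosure ?_
  simp only [Submodule.isOrtho_iSup_left, Submodule.isOrtho_iSup_right]
  intro l _ l' _
  exact isOrtho_toVecL2 fun f hf g hg =>
    integral_inner_vecHarmonicSpace Y hY (fun he => h (Prod.ext_iff.1 he).1) hf hg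

/-- Density becomes equality because the parts are closed and mutually orthogonal: `u` minus the sum
of its three projections is orthogonal to every part, hence to a dense subspace, hence zero. -/
theorem iSup_vecL2Part {ι : ℕ → Type*} (Y : (l : ℕ) → ι l → S2 → ℝ)
    (hY : ∀ l, IsSphericalHarmonicBasis l (Y l)) : ⨆ k, vecL2Part Y k = ⊤ := by
  have hbot := (Submodule.topologicalClosure_eq_top_iff).1 (topologicalClosure_iSup_vecL2Part Y hY)
  have (k : Kind) : CompleteSpace (vecL2Part Y k) :=
    (Submodule.isClosed_topologicalClosure _).completeSpace_coe
  rw [eq_top_iff]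
  rintro u -
  set P : Kind → VecL2 := fun k => (vecL2Part Y k).starProjection u
  have hPm (k : Kind) : P k ∈ vecL2Part Y k := Submodule.starProjection_apply_mem _ _
  have hu (k : Kind) : u - P k ∈ (vecL2Part Y k)ᗮ :=
    Submodule.sub_starProjection_mem_orthogonal _
  have hne {k k' : Kind} (h : k ≠ k') : P k ∈ (vecL2Part Y k')ᗮ :=
    isOrtho_vecL2Part Y hY h (hPm k)
  have hv : u - (P .plus + P .minus + P .zero) ∈ (⨆ k, vecL2Part Y k)ᗮ := by
    rw [← Submodule.iInf_orthogonal, Submodule.mem_iInf]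
    intro k
    cases k with
    | plus =>
      -- Regrouped so that `u` minus its own projection comes first; the other two projections lie
      -- in the complement by mutual orthogonality.
      rw [show u - (P .plus + P .minus + P .zero) = u - P .plus - P .minus - P .zero by abel]
      exact sub_mem (sub_mem (hu _) (hne (by decide))) (hne (by decide))
    | minus =>
      rw [show u - (P .plus + P .minus + P .zero) = u - P .minus - P .plus - P .zero by abel]
      exact sub_mem (sub_mem (hu _) (hne (by decide))) (hne (by decide))
    | zero =>
      rw [show u - (P .plus + P .minus + P .zero) = u - P .zero - P .plus - P .minus by abel]
      exact sub_mem (sub_mem (hu _) (hne (by decide))) (hne (by decide))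
  rw [hbot, Submodule.mem_bot, sub_eq_zero] at hv
  rw [hv]
  have hm (k : Kind) : P k ∈ ⨆ k, vecL2Part Y k := Submodule.mem_iSup_of_mem k (hPm k)
  exact add_mem (add_mem (hm _) (hm _)) (hm _)

theorem isRestrictionOfVecHarmonic_of_mem {ι : ℕ → Type*} (Y : (l : ℕ) → ι l → S2 → ℝ)
    (hY : ∀ l, IsSphericalHarmonicBasis l (Y l)) {k : Kind} {l n : ℕ}
    (h : ∀ p ∈ harmonicHomogeneous l, ∀ i, vecPoly k l p i ∈ harmonicHomogeneous n)
    {f : S2 → E3} (hf : f ∈ vecHarmonicSpace Y k l) : IsRestrictionOfVecHarmonic n f := by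
  rw [vecHarmonicSpace_eq_map Y hY] at hf
  obtain ⟨p, hp, rfl⟩ := hf
  exact ⟨vecPoly k l p, h p hp, fun _ _ => rfl⟩

end

theorem mainTheorem12 {ι : ℕ → Type*} (Y : (l : ℕ) → ι l → S2 → ℝ)
    (hY : ∀ l, IsSphericalHarmonicBasis l (Y l)) :
    -- the spaces consist of square integrable fields
    (∀ (k : Kind) (l : ℕ), ∀ f ∈ vecHarmonicSpace Y k l, MemLp f 2 surfaceMeasure) ∧
    -- any two different ones among all these spaces are orthogonal
    (∀ (k k' : Kind) (l l' : ℕ), (k, l) ≠ (k', l') →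
      ∀ f ∈ vecHarmonicSpace Y k l, ∀ g ∈ vecHarmonicSpace Y k' l',
        ∫ η, inner ℝ (f η) (g η) ∂surfaceMeasure = 0) ∧
    -- their elements are restrictions of harmonic homogeneous vector polynomials
    (∀ l : ℕ, ∀ f ∈ vecHarmonicSpace Y Kind.plus l, IsRestrictionOfVecHarmonic (l + 1) f) ∧
    (∀ l : ℕ, 1 ≤ l →
      ∀ f ∈ vecHarmonicSpace Y Kind.minus l, IsRestrictionOfVecHarmonic (l - 1) f) ∧
    (∀ l : ℕ, 1 ≤ l →
      ∀ f ∈ vecHarmonicSpace Y Kind.zero l, IsRestrictionOfVecHarmonic l f) ∧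
    -- the whole space is the orthogonal direct sum of the three closed subspaces
    OrthogonalFamily ℝ (fun k : Kind => vecL2Part Y k)
      (fun k : Kind => (vecL2Part Y k).subtypeₗᵢ) ∧
    DirectSum.IsInternal (fun k : Kind => vecL2Part Y k) := by
  have hortho : OrthogonalFamily ℝ (fun k : Kind => vecL2Part Y k)
      (fun k : Kind => (vecL2Part Y k).subtypeₗᵢ) :=
    OrthogonalFamily.of_pairwise fun _ _ h => isOrtho_vecL2Part Y hY h
  refine ⟨fun k l f hf => ?_, fun k k' l l' h f hf g hg =>
    integral_inner_vecHarmonicSpace Y hY h hf hg, fun l f hf =>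
    isRestrictionOfVecHarmonic_of_mem Y hY (fun p hp => vecPoly_plus_mem hp) hf, fun l _ f hf =>
    isRestrictionOfVecHarmonic_of_mem Y hY (fun p hp => pderiv_mem_harmonicHomogeneous hp) hf,
    fun l _ f hf =>
    isRestrictionOfVecHarmonic_of_mem Y hY (fun p hp => rotDeriv_mem_harmonicHomogeneous hp) hf,
    hortho, ?_⟩
  · rw [vecHarmonicSpace_eq_map Y hY] at hf
    obtain ⟨p, -, rfl⟩ := hf
    exact memLp_restrictVec _
  · exact DirectSum.isInternal_submodule_of_iSupIndep_of_iSup_eq_top hortho.independent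
      (iSup_vecL2Part Y hY)
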